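/- Let $\gamma>0$ and $0<\beta\le 1$ with $\beta\gamma<1$. Put $$\lambda^{\pm}=\gamma^{-1/2}+\gamma^{1/2}\pm 2\sqrt{\beta(1+\gamma-\gamma\beta)},\qquad \Delta(x)=(\lambda^{+}-x)(x-\lambda^{-}),\qquad R(y)=\sqrt{-\gamma\,\Delta(y^2)},\qquad w=1+\gamma-2\beta\gamma ,$$ and, for $y\ge\sqrt{\lambda^+}$, $$\kappa_1=\frac{\sqrt\gamma y^2+1-\gamma-R(y)}{2y},\quad \kappa_2=\frac{1-\beta\gamma}{y},\quad \kappa_3=\frac{\sqrt\gamma(1+\gamma)y^2-w^2-wR(y)}{2\gamma(1-\beta\gamma)y^3},\quad \kappa_4=\frac{\sqrt\gamma y^2-w-R(y)}{2\gamma y^2},$$ $$\kappa_5=\frac{-(1+\beta)\sqrt\gamma y^2+(1-\beta)(w+R(y))}{2(1-\beta\gamma)y^2},\quad \kappa_6=\frac{\sqrt\gamma y^2-(1-\gamma)-R(y)}{2\gamma y},\quad \kappa_7=\frac{1-\beta}{y},$$ $$\kappa_8=(1-\beta)\frac{\sqrt\gamma y^2+1-\gamma-R(y)}{2(1-\beta\gamma)y},\quad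 \kappa_9=\sqrt\gamma(1-\beta)(1-\beta\gamma)\frac{\sqrt\gamma y^2+w-R(y)}{2(1+\gamma-\beta\gamma)y}.$$ For $y>\sqrt{\lambda^+}$ let $\tau_i=-\frac y2(\kappa_i/y)'$ for $i\le 3$, $\tau_i=-\frac12\kappa_i'$ for $i=4,5$, and $\tau_i=-\frac1{2y}(y\kappa_i)'$ for $6\le i\le 9$, where $'$ is the derivative in $y$. Let $$\mathcal K(y)=\begin{pmatrix}\kappa_1&\kappa_2&0&0&0&0\\ \kappa_2&\kappa_2&0&0&0&-(1-\gamma\beta)\\ 0&0&\kappa_3&\kappa_4&\kappa_5&0\\ 0&0&\kappa_4&\kappa_6&\kappa_7&0\\ 0&0&\kappa_5&\kappa_7&\kappa_8&0\\ 0&-(1-\gamma\beta)&0&0&0&\kappa_9\end{pmatrix},\qquad \mathcal H=\begin{pmatrix}0&J\\ J&0\end{pmatrix},\quad J=\mathrm{diag}(1,-1,1),$$ and let $\mathcal T(y)$ be the matrix obtained from $\mathcal K(y)$ by replacing each $\kappa_i$ by $\tau_i$ and the two entries $-(1-\gamma\beta)$ by $0$. Then the following holds. 1. For every $y\ge\sqrt{\lambda^+}$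 the equation $\det(\mathcal K(y)-s\mathcal H)=0$ has exactly one root $s>0$, denoted $s(y)$. Define the detection threshold $\sigma^*_{\gamma,\beta}=1/s(\sqrt{\lambda^+})$. 2. For every $\sigma>\sigma^*_{\gamma,\beta}$ there is exactly one $y>\sqrt{\lambda^+}$ with $s(y)=1/\sigma$, denoted $y(\sigma)$. 3. For every $\sigma>\sigma^*_{\gamma,\beta}$ the vectors $d\in\ker\big(\mathcal K(y(\sigma))-\tfrac1\sigma\mathcal H\big)\subset\mathbb R^6$ with $\langle d,\mathcal T(y(\sigma))d\rangle=1$ are exactly two antipodal vectors $\pm d$. Hence the limiting overlaps $$\mathcal U_{\gamma,\beta}(\sigma)=|d_4|/\sigma,\qquad \mathcal V_{\gamma,\beta}(\sigma)=|d_1|/\sigma$$ of the left, respectively right, singular vectors are well defined. 4. $$\lim_{\sigma\downarrow\sigma^*_{\gamma,\beta}}\mathcal U_{\gamma,\beta}(\sigma)=0,\qquad \lim_{\sigma\downarrow\sigma^*_{\gamma,\beta}}\mathcal V_{\gamma,\beta}(\sigma)=0 .$$ -/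

import Mathlib

open Filter Topology Set

namespace RandSVD

noncomputable section

/-- The lower edge of the limiting bulk of squared singular values. -/
def edgeLower (γ β : ℝ) : ℝ :=
  1 / √γ + √γ - 2 * √(β * (1 + γ - γ * β))

/-- The upper edge of the limiting bulk of squared singular values. -/
def edgeUpper (γ β : ℝ) : ℝ :=
  1 / √γ + √γ + 2 * √(β * (1 + γ - γ * β))

/-- `Δ(x) = (edgeUpper - x) (x - edgeLower)`; it is negative for `x > edgeUpper`. -/
def Delta (γ β x : ℝ) : ℝ :=
  (edgeUpper γ β - x) * (x - edgeLower γ β)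

/-- The square root `√(-γ Δ(y²))` which occurs in the functions `κ⁽ⁱ⁾`. -/
def rootDelta (γ β y : ℝ) : ℝ :=
  √(-γ * Delta γ β (y ^ 2))

def kappa1 (γ β y : ℝ) : ℝ :=
  (√γ * y ^ 2 + 1 - γ - rootDelta γ β y) / (2 * y)

def kappa2 (γ β y : ℝ) : ℝ :=
  (1 - β * γ) * (1 / y)

def kappa3 (γ β y : ℝ) : ℝ :=
  (√γ * (1 + γ) * y ^ 2 - (1 + γ - 2 * β * γ) ^ 2
      - (1 + γ - 2 * β * γ) * rootDelta γ β y) / (2 * γ * (1 - β * γ) * y ^ 3)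

def kappa4 (γ β y : ℝ) : ℝ :=
  (√γ * y ^ 2 - (1 + γ - 2 * β * γ) - rootDelta γ β y) / (2 * γ * y ^ 2)

def kappa5 (γ β y : ℝ) : ℝ :=
  (-(1 + β) * √γ * y ^ 2 + (1 - β) * ((1 + γ - 2 * β * γ) + rootDelta γ β y))
    / (2 * (1 - β * γ) * y ^ 2)

def kappa6 (γ β y : ℝ) : ℝ :=
  (√γ * y ^ 2 - (1 - γ) - rootDelta γ β y) / (2 * γ * y)

def kappa7 (β y : ℝ) : ℝ :=
  (1 - β) / y

def kappa8 (γ β y : ℝ) : ℝ :=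
  (1 - β) * ((√γ * y ^ 2 + 1 - γ - rootDelta γ β y) / (2 * (1 - β * γ) * y))

def kappa9 (γ β y : ℝ) : ℝ :=
  √γ * (1 - β) * (1 - β * γ) *
    ((√γ * y ^ 2 + (1 + γ - 2 * β * γ) - rootDelta γ β y) / (2 * (1 + γ - β * γ) * y))

/-- The symmetric `6 × 6` matrix `𝒦(y)`. -/
def matK (γ β y : ℝ) : Matrix (Fin 6) (Fin 6) ℝ :=
  !![kappa1 γ β y, kappa2 γ β y, 0, 0, 0, 0;
     kappa2 γ β y, kappa2 γ β y, 0, 0, 0, -(1 - γ * β);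
     0, 0, kappa3 γ β y, kappa4 γ β y, kappa5 γ β y, 0;
     0, 0, kappa4 γ β y, kappa6 γ β y, kappa7 β y, 0;
     0, 0, kappa5 γ β y, kappa7 β y, kappa8 γ β y, 0;
     0, -(1 - γ * β), 0, 0, 0, kappa9 γ β y]

/-- The constant symmetric `6 × 6` matrix `ℋ`, with off-diagonal blocks `diag(1, -1, 1)`. -/
def matH : Matrix (Fin 6) (Fin 6) ℝ :=
  !![0, 0, 0, 1, 0, 0;
     0, 0, 0, 0, -1, 0;
     0, 0, 0, 0, 0, 1;
     1, 0, 0, 0, 0, 0;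
     0, -1, 0, 0, 0, 0;
     0, 0, 1, 0, 0, 0]

/-- `τ⁽ⁱ⁾ = -(y/2) (κ⁽ⁱ⁾(y) / y)'`, for `i = 1, 2, 3`. -/
def tauA (κ : ℝ → ℝ) (y : ℝ) : ℝ :=
  -(1 / 2) * y * deriv (fun t => 1 / t * κ t) y

/-- `τ⁽ⁱ⁾ = -(1/2) (κ⁽ⁱ⁾(y))'`, for `i = 4, 5`. -/
def tauB (κ : ℝ → ℝ) (y : ℝ) : ℝ :=
  -(1 / 2) * deriv κ y

/-- `τ⁽ⁱ⁾ = -(1/(2y)) (y κ⁽ⁱ⁾(y))'`, for `i = 6, 7, 8, 9`. -/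
def tauC (κ : ℝ → ℝ) (y : ℝ) : ℝ :=
  -(1 / (2 * y)) * deriv (fun t => t * κ t) y

/-- The symmetric `6 × 6` matrix `𝒯(y)`, for `y > √edgeUpper`. -/
def matT (γ β y : ℝ) : Matrix (Fin 6) (Fin 6) ℝ :=
  !![tauA (kappa1 γ β) y, tauA (kappa2 γ β) y, 0, 0, 0, 0;
     tauA (kappa2 γ β) y, tauA (kappa2 γ β) y, 0, 0, 0, 0;
     0, 0, tauA (kappa3 γ β) y, tauB (kappa4 γ β) y, tauB (kappa5 γ β) y, 0;
     0, 0, tauB (kappa4 γ β) y, tauC (kappa6 γ β) y, tauC (kappa7 β) y, 0;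
     0, 0, tauB (kappa5 γ β) y, tauC (kappa7 β) y, tauC (kappa8 γ β) y, 0;
     0, 0, 0, 0, 0, tauC (kappa9 γ β) y]

/-- `s` is a positive root of the generalized eigenvalue problem `det (𝒦(y) - s ℋ) = 0`. -/
def IsPosRoot (γ β y s : ℝ) : Prop :=
  0 < s ∧ (matK γ β y - s • matH).det = 0

/-- The positive root `s(y)` of `det (𝒦(y) - s ℋ) = 0`, for `y ≥ √edgeUpper`
(at `y = √edgeUpper` the formulas for `𝒦` are evaluated by continuity). -/
def posRoot (γ β y : ℝ) : ℝ :=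
  Classical.epsilon (IsPosRoot γ β y)

/-- The spike detection threshold `σ* = 1 / s(√edgeUpper)`. -/
def threshold (γ β : ℝ) : ℝ :=
  1 / posRoot γ β √(edgeUpper γ β)

/-- The spike-forward map `σ ↦ s⁻¹(1/σ)`, where `s⁻¹` is the functional inverse of the map `s(·)`
on `(√edgeUpper, ∞)`. -/
def spikeForward (γ β σ : ℝ) : ℝ :=
  Function.invFunOn (posRoot γ β) (Ioi √(edgeUpper γ β)) (1 / σ)

/-- The vectors `d ∈ ker (𝒦(y) - (1/σ) ℋ)`, with `y` the image of `σ` under the spike-forward map,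
that are normalized by `⟨d, 𝒯(y) d⟩ = 1`. -/
def normalizedKernel (γ β σ : ℝ) : Set (Fin 6 → ℝ) :=
  {d | (matK γ β (spikeForward γ β σ) - (1 / σ) • matH).mulVec d = 0 ∧
    d ⬝ᵥ (matT γ β (spikeForward γ β σ)).mulVec d = 1}

/-- A choice of a normalized kernel vector (for `σ > σ*` there are two, which are antipodal). -/
def kernelVector (γ β σ : ℝ) : Fin 6 → ℝ :=
  Classical.epsilon (fun d => d ∈ normalizedKernel γ β σ)

/-- The limiting overlap `𝒰(σ) = |d₄| / σ` of the left singular vectors. -/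
def overlapU (γ β σ : ℝ) : ℝ :=
  |kernelVector γ β σ 3| / σ

/-- The limiting overlap `𝒱(σ) = |d₁| / σ` of the right singular vectors. -/
def overlapV (γ β σ : ℝ) : ℝ :=
  |kernelVector γ β σ 0| / σ

end

end RandSVD

/-! ### Uniformization of the curve carrying `y ^ 2` and `rootDelta`. -/

namespace RandSVD

/-! Write γ = g², c = βg², e = 1 + g² − βg², so that c + e = 1 + γ. The square root in the κ's is
removed by the parameter z with g y² = (z + c)(z + e)/z and R = z − ce/z. The half-line above the
bulk edge corresponds bijectively to z > √(ce), and the edge is the branch point z² = ce. In terms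
of z every κ is a power of y times a rational function.

The determinant of the pencil then factors (`det_pencil`): apart from s² + βg > 0, what remains is a
quadratic in u = s² with exactly one positive root. It is affine in z, so the root relation reads z
= `paramOfRoot` u, a strictly decreasing function of u. This gives the unique root and the inverse
of s(·) beyond the threshold.

The kernel at the root is a line with an explicit generator (`spanVec_mem_ker`,
`exists_smul_spanVec`). Each τ carries the factor dz/dy = 2gyz²/(z² − ce), and the 𝒯-form of the
generator has a closed positive value with z² − ce in its denominator (`spanVec_matT`). After
normalization both squared overlaps are therefore continuous functions of u with a factor z² − ce.
That factor vanishes exactly at the branch point, which is the detection threshold. -/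

/-- The uniformizing parameter of the curve `y ↦ (y², rootDelta y)`. -/
noncomputable def unif (γ β y : ℝ) : ℝ :=
  (√γ * y ^ 2 - (1 + γ) + rootDelta γ β y) / 2

/-- The standing assumptions on the parameters, with `γ = g²`. -/
structure Params (g β : ℝ) : Prop where
  g_pos : 0 < g
  β_pos : 0 < β
  β_le : β ≤ 1
  c_lt : β * g ^ 2 < 1

namespace Params

variable {g β : ℝ} (h : Params g β)
include h

theorem sqrt_sq : √(g ^ 2) = g := Real.sqrt_sq h.g_pos.le

theorem c_pos : 0 < β * g ^ 2 := mul_pos h.β_pos (pow_pos h.g_pos 2)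

theorem e_pos : 0 < 1 + g ^ 2 - β * g ^ 2 := by
  have := h.c_lt; have := h.g_pos; nlinarith [sq_nonneg g]

theorem ce_pos : 0 < β * g ^ 2 * (1 + g ^ 2 - β * g ^ 2) := mul_pos h.c_pos h.e_pos

theorem q_pos : 0 < 1 - β * g ^ 2 := sub_pos.2 h.c_lt

theorem b_nonneg : 0 ≤ 1 - β := sub_nonneg.2 h.β_le

theorem g_mul_edgeUpper : g * edgeUpper (g ^ 2) β =
    1 + g ^ 2 + 2 * √(β * g ^ 2 * (1 + g ^ 2 - β * g ^ 2)) := by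
  have hg := h.g_pos
  have : √(β * g ^ 2 * (1 + g ^ 2 - β * g ^ 2)) = g * √(β * (1 + g ^ 2 - g ^ 2 * β)) := by
    rw [show β * g ^ 2 * (1 + g ^ 2 - β * g ^ 2) = g ^ 2 * (β * (1 + g ^ 2 - g ^ 2 * β)) by ring,
      Real.sqrt_mul (sq_nonneg g), h.sqrt_sq]
  rw [this, edgeUpper, h.sqrt_sq]
  field_simp

theorem g_mul_edgeLower : g * edgeLower (g ^ 2) β =
    1 + g ^ 2 - 2 * √(β * g ^ 2 * (1 + g ^ 2 - β * g ^ 2)) := by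
  have h1 := h.g_mul_edgeUpper
  have hg := h.g_pos
  have : g * edgeUpper (g ^ 2) β + g * edgeLower (g ^ 2) β = 2 * (1 + g ^ 2) := by
    rw [edgeUpper, edgeLower, h.sqrt_sq]
    field_simp
    ring
  linarith

theorem edgeUpper_pos : 0 < edgeUpper (g ^ 2) β := by
  have h1 := h.g_mul_edgeUpper
  have h2 : 0 < g * edgeUpper (g ^ 2) β := by rw [h1]; positivity
  exact pos_of_mul_pos_right h2 h.g_pos.le

theorem neg_mul_Delta (y : ℝ) : -(g ^ 2) * Delta (g ^ 2) β (y ^ 2) =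
    (g * y ^ 2 - (1 + g ^ 2)) ^ 2 - 4 * (β * g ^ 2 * (1 + g ^ 2 - β * g ^ 2)) := by
  have h1 := h.g_mul_edgeUpper
  have h2 := h.g_mul_edgeLower
  have h3 := Real.sq_sqrt h.ce_pos.le
  have : -(g ^ 2) * Delta (g ^ 2) β (y ^ 2) =
      (g * y ^ 2 - g * edgeUpper (g ^ 2) β) * (g * y ^ 2 - g * edgeLower (g ^ 2) β) := by
    rw [Delta]; ring
  rw [this, h1, h2]
  linear_combination -4 * h3

section
variable {y : ℝ} (hy : √(edgeUpper (g ^ 2) β) ≤ y)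
include hy

theorem y_pos : 0 < y := (Real.sqrt_pos.2 h.edgeUpper_pos).trans_le hy

theorem two_sqrt_le : 2 * √(β * g ^ 2 * (1 + g ^ 2 - β * g ^ 2)) ≤ g * y ^ 2 - (1 + g ^ 2) := by
  have h1 := h.g_mul_edgeUpper
  have h2 : edgeUpper (g ^ 2) β ≤ y ^ 2 := (Real.sqrt_le_left (h.y_pos hy).le).1 hy
  nlinarith [h.g_pos]

theorem rootDelta_sq : rootDelta (g ^ 2) β y ^ 2 =
    (g * y ^ 2 - (1 + g ^ 2)) ^ 2 - 4 * (β * g ^ 2 * (1 + g ^ 2 - β * g ^ 2)) := by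
  rw [rootDelta, h.neg_mul_Delta, Real.sq_sqrt]
  have h1 := h.two_sqrt_le hy
  have h3 := Real.sq_sqrt h.ce_pos.le
  have h4 := Real.sqrt_nonneg (β * g ^ 2 * (1 + g ^ 2 - β * g ^ 2))
  nlinarith

theorem sqrt_le_unif : √(β * g ^ 2 * (1 + g ^ 2 - β * g ^ 2)) ≤ unif (g ^ 2) β y := by
  have h1 := h.two_sqrt_le hy
  have : 0 ≤ rootDelta (g ^ 2) β y := Real.sqrt_nonneg _
  rw [unif, h.sqrt_sq]
  linarith

theorem unif_pos : 0 < unif (g ^ 2) β y :=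
  (Real.sqrt_pos.2 h.ce_pos).trans_le (h.sqrt_le_unif hy)

/-- `unif` is the larger root of z² − (g y² − (1 + g²)) z + ce = 0. The other root is ce/z, and
`rootDelta` is the difference of the two. -/
theorem g_mul_sq : g * y ^ 2 = (unif (g ^ 2) β y + β * g ^ 2) *
    (unif (g ^ 2) β y + (1 + g ^ 2 - β * g ^ 2)) / unif (g ^ 2) β y := by
  rw [eq_div_iff (h.unif_pos hy).ne']
  have h1 := h.rootDelta_sq hy
  rw [unif, h.sqrt_sq]
  linear_combination (-1 / 4) * h1

theorem rootDelta_eq : rootDelta (g ^ 2) β y = unif (g ^ 2) β y -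
    β * g ^ 2 * (1 + g ^ 2 - β * g ^ 2) / unif (g ^ 2) β y := by
  have h1 := h.g_mul_sq hy
  have h2 : 2 * unif (g ^ 2) β y = g * y ^ 2 - (1 + g ^ 2) + rootDelta (g ^ 2) β y := by
    rw [unif, h.sqrt_sq]; ring
  have hz := h.unif_pos hy
  field_simp at h1 ⊢
  linear_combination unif (g ^ 2) β y * (-h2) - h1

end

theorem unif_edge : unif (g ^ 2) β √(edgeUpper (g ^ 2) β) =
    √(β * g ^ 2 * (1 + g ^ 2 - β * g ^ 2)) := by
  have h1 := h.rootDelta_sq le_rfl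
  have h2 : g * √(edgeUpper (g ^ 2) β) ^ 2 - (1 + g ^ 2) =
      2 * √(β * g ^ 2 * (1 + g ^ 2 - β * g ^ 2)) := by
    rw [Real.sq_sqrt h.edgeUpper_pos.le, h.g_mul_edgeUpper]; ring
  rw [h2, mul_pow, Real.sq_sqrt h.ce_pos.le] at h1
  have h3 : rootDelta (g ^ 2) β √(edgeUpper (g ^ 2) β) = 0 := by
    apply pow_eq_zero_iff two_ne_zero |>.1; linarith
  rw [unif, h.sqrt_sq, h2, h3]; ring

theorem rootDelta_pos {y : ℝ} (hy : √(edgeUpper (g ^ 2) β) < y) :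
    0 < rootDelta (g ^ 2) β y := by
  have h0 : 0 < y := h.y_pos hy.le
  have h2 : edgeUpper (g ^ 2) β < y ^ 2 := (Real.sqrt_lt' h0).1 hy
  have h1 : 2 * √(β * g ^ 2 * (1 + g ^ 2 - β * g ^ 2)) < g * y ^ 2 - (1 + g ^ 2) := by
    have h1 := h.g_mul_edgeUpper
    nlinarith [h.g_pos]
  have h3 := Real.sq_sqrt h.ce_pos.le
  have h4 := Real.sqrt_nonneg (β * g ^ 2 * (1 + g ^ 2 - β * g ^ 2))
  rw [rootDelta, h.neg_mul_Delta]
  apply Real.sqrt_pos.2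
  nlinarith

theorem sqrt_lt_unif {y : ℝ} (hy : √(edgeUpper (g ^ 2) β) < y) :
    √(β * g ^ 2 * (1 + g ^ 2 - β * g ^ 2)) < unif (g ^ 2) β y := by
  have h1 := h.two_sqrt_le hy.le
  have := h.rootDelta_pos hy
  rw [unif, h.sqrt_sq]
  linarith

theorem ce_lt_unif_sq {y : ℝ} (hy : √(edgeUpper (g ^ 2) β) < y) :
    β * g ^ 2 * (1 + g ^ 2 - β * g ^ 2) < unif (g ^ 2) β y ^ 2 :=
  (Real.sqrt_lt' (h.unif_pos hy.le)).1 (h.sqrt_lt_unif hy)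

/-- Every value above the edge value is attained by the uniformizing parameter. -/
theorem exists_unif_eq {z : ℝ} (hz : √(β * g ^ 2 * (1 + g ^ 2 - β * g ^ 2)) < z) :
    ∃ y, √(edgeUpper (g ^ 2) β) < y ∧ unif (g ^ 2) β y = z := by
  have h4 := Real.sqrt_pos.2 h.ce_pos
  have h3 := Real.sq_sqrt h.ce_pos.le
  have hz0 : 0 < z := h4.trans hz
  have hg := h.g_pos
  have hc := h.c_pos
  have he := h.e_pos
  -- The candidate for y² is dictated by `g_mul_sq`.
  set x := (z + β * g ^ 2) * (z + (1 + g ^ 2 - β * g ^ 2)) / (z * g) with hx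
  have hgx : g * x = z + (1 + g ^ 2) + β * g ^ 2 * (1 + g ^ 2 - β * g ^ 2) / z := by
    rw [hx]; field_simp; ring
  have hx0 : 0 < x := by positivity
  have hzz : β * g ^ 2 * (1 + g ^ 2 - β * g ^ 2) < z ^ 2 := (Real.sqrt_lt' hz0).1 hz
  refine ⟨√x, Real.sqrt_lt_sqrt h.edgeUpper_pos.le ?_, ?_⟩
  · have h1 := h.g_mul_edgeUpper
    have : 2 * √(β * g ^ 2 * (1 + g ^ 2 - β * g ^ 2)) <
        z + β * g ^ 2 * (1 + g ^ 2 - β * g ^ 2) / z := by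
      rw [← sub_pos, show z + β * g ^ 2 * (1 + g ^ 2 - β * g ^ 2) / z -
        2 * √(β * g ^ 2 * (1 + g ^ 2 - β * g ^ 2)) =
        (z - √(β * g ^ 2 * (1 + g ^ 2 - β * g ^ 2))) ^ 2 / z by
          field_simp; linear_combination -h3]
      have := sub_pos.2 hz
      positivity
    exact lt_of_mul_lt_mul_left (by linarith) hg.le
  · rw [unif, h.sqrt_sq, rootDelta, h.neg_mul_Delta, Real.sq_sqrt hx0.le, hgx]
    rw [show (z + (1 + g ^ 2) + β * g ^ 2 * (1 + g ^ 2 - β * g ^ 2) / z - (1 + g ^ 2)) ^ 2 -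
      4 * (β * g ^ 2 * (1 + g ^ 2 - β * g ^ 2)) =
      (z - β * g ^ 2 * (1 + g ^ 2 - β * g ^ 2) / z) ^ 2 by field_simp; ring, Real.sqrt_sq]
    · ring
    · rw [sub_nonneg, div_le_iff₀ hz0]; nlinarith

theorem unif_injOn : InjOn (unif (g ^ 2) β) (Ici √(edgeUpper (g ^ 2) β)) := by
  intro y₁ h₁ y₂ h₂ heq
  have e1 := h.g_mul_sq h₁
  have e2 := h.g_mul_sq h₂
  rw [heq, ← e2] at e1
  have := mul_left_cancel₀ h.g_pos.ne' e1
  exact (sq_eq_sq₀ (h.y_pos h₁).le (h.y_pos h₂).le).1 this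

end Params

/-! The functions `κ` in terms of the uniformizing parameter, up to powers of `y`. -/

noncomputable section

/-- The power of y split off is the one that `tauA`, `tauB` or `tauC` cancels before
differentiating, so each τ becomes a z-derivative times dz/dy. There is no `hat7`, since y κ₇ is
constant. -/
def hat1 (g β z : ℝ) : ℝ :=
  g * (z + β * g ^ 2 * (1 + g ^ 2 - β * g ^ 2)) /
    ((z + β * g ^ 2) * (z + (1 + g ^ 2 - β * g ^ 2)))

def hat2 (g β z : ℝ) : ℝ :=
  g * (1 - β * g ^ 2) * z / ((z + β * g ^ 2) * (z + (1 + g ^ 2 - β * g ^ 2)))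

def hat3 (g β z : ℝ) : ℝ :=
  β * g ^ 2 * z / ((1 - β * g ^ 2) * (z + β * g ^ 2) ^ 2)

def hat4 (g β z : ℝ) : ℝ := β * g / (z + β * g ^ 2)

def hat5 (g β z : ℝ) : ℝ := -(β * g * (z + g ^ 2)) / ((1 - β * g ^ 2) * (z + β * g ^ 2))

def hat6 (g β z : ℝ) : ℝ := (z + β * (1 + g ^ 2 - β * g ^ 2)) / z

def hat8 (g β z : ℝ) : ℝ :=
  (1 - β) * (z + β * g ^ 2 * (1 + g ^ 2 - β * g ^ 2)) / ((1 - β * g ^ 2) * z)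

def hat9 (g β z : ℝ) : ℝ := g * (1 - β) * (1 - β * g ^ 2) * (z + β * g ^ 2) / z

end

namespace Params

variable {g β : ℝ} (h : Params g β) {y : ℝ} (hy : √(edgeUpper (g ^ 2) β) ≤ y)
include h hy

theorem kappa1_eq : kappa1 (g ^ 2) β y = y * hat1 g β (unif (g ^ 2) β y) := by
  have h1 := h.g_mul_sq hy
  have hR := h.rootDelta_eq hy
  have hz := h.unif_pos hy
  have hy0 := h.y_pos hy
  have hβ := h.β_pos
  have he := h.e_pos
  have hg := h.g_pos
  rw [kappa1, hat1, h.sqrt_sq, hR]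
  generalize unif (g ^ 2) β y = z at *
  have hyy : y ^ 2 = (z + β * g ^ 2) * (z + (1 + g ^ 2 - β * g ^ 2)) / (z * g) := by
    field_simp at h1 ⊢; linarith
  -- The factor e is kept as an atom with known sign while denominators are cleared, and expanded
  -- only for the final polynomial identity.
  generalize hE : 1 + g ^ 2 - β * g ^ 2 = E at *
  rw [h1]
  rw [div_eq_iff (by positivity), show ∀ t : ℝ, y * t * (2 * y) = t * (2 * y ^ 2) by
    intro t; ring, hyy]
  field_simp
  rw [← hE]
  ring

theorem kappa2_eq : kappa2 (g ^ 2) β y = y * hat2 g β (unif (g ^ 2) β y) := by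
  have h1 := h.g_mul_sq hy
  have hz := h.unif_pos hy
  have hy0 := h.y_pos hy
  have hβ := h.β_pos
  have he := h.e_pos
  rw [kappa2, hat2]
  generalize unif (g ^ 2) β y = z at *
  generalize hE : 1 + g ^ 2 - β * g ^ 2 = E at *
  field_simp at h1 ⊢
  linear_combination -(1 - β * g ^ 2) * h1

theorem kappa4_eq : kappa4 (g ^ 2) β y = hat4 g β (unif (g ^ 2) β y) := by
  have h1 := h.g_mul_sq hy
  have hR := h.rootDelta_eq hy
  have hz := h.unif_pos hy
  have hy0 := h.y_pos hy
  have hβ := h.β_pos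
  have he := h.e_pos
  have hg := h.g_pos
  rw [kappa4, hat4, h.sqrt_sq, hR]
  generalize unif (g ^ 2) β y = z at *
  have hyy : y ^ 2 = (z + β * g ^ 2) * (z + (1 + g ^ 2 - β * g ^ 2)) / (z * g) := by
    field_simp at h1 ⊢; linarith
  generalize hE : 1 + g ^ 2 - β * g ^ 2 = E at *
  rw [h1, hyy]
  field_simp
  rw [← hE]
  ring

theorem kappa3_eq : kappa3 (g ^ 2) β y = y * hat3 g β (unif (g ^ 2) β y) := by
  have h1 := h.g_mul_sq hy
  have hR := h.rootDelta_eq hy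
  have hz := h.unif_pos hy
  have hy0 := h.y_pos hy
  have hβ := h.β_pos
  have he := h.e_pos
  have hg := h.g_pos
  have hq := h.q_pos
  rw [kappa3, hat3, h.sqrt_sq, hR]
  generalize unif (g ^ 2) β y = z at *
  have hyy : y ^ 2 = (z + β * g ^ 2) * (z + (1 + g ^ 2 - β * g ^ 2)) / (z * g) := by
    field_simp at h1 ⊢; linarith
  generalize hE : 1 + g ^ 2 - β * g ^ 2 = E at *
  generalize hQ : 1 - β * g ^ 2 = Q at *
  rw [show g * (1 + g ^ 2) * y ^ 2 = (1 + g ^ 2) * (g * y ^ 2) by ring, h1,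
    div_eq_iff (by positivity), show ∀ t : ℝ, y * t * (2 * g ^ 2 * Q * y ^ 3) =
      t * (2 * g ^ 2 * Q * (y ^ 2) ^ 2) by intro t; ring, hyy]
  field_simp
  rw [← hE]
  ring

theorem kappa5_eq : kappa5 (g ^ 2) β y = hat5 g β (unif (g ^ 2) β y) := by
  have h1 := h.g_mul_sq hy
  have hR := h.rootDelta_eq hy
  have hz := h.unif_pos hy
  have hy0 := h.y_pos hy
  have hβ := h.β_pos
  have he := h.e_pos
  have hg := h.g_pos
  have hq := h.q_pos
  rw [kappa5, hat5, h.sqrt_sq, hR]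
  generalize unif (g ^ 2) β y = z at *
  have hyy : y ^ 2 = (z + β * g ^ 2) * (z + (1 + g ^ 2 - β * g ^ 2)) / (z * g) := by
    field_simp at h1 ⊢; linarith
  generalize hE : 1 + g ^ 2 - β * g ^ 2 = E at *
  generalize hQ : 1 - β * g ^ 2 = Q at *
  rw [mul_assoc, h1, hyy]
  field_simp
  rw [← hE]
  ring

theorem kappa6_eq : kappa6 (g ^ 2) β y = hat6 g β (unif (g ^ 2) β y) / y := by
  have h1 := h.g_mul_sq hy
  have hR := h.rootDelta_eq hy
  have hz := h.unif_pos hy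
  have hy0 := h.y_pos hy
  have hg := h.g_pos
  rw [kappa6, hat6, h.sqrt_sq, hR, h1]
  generalize unif (g ^ 2) β y = z at *
  field_simp
  ring

theorem kappa8_eq : kappa8 (g ^ 2) β y = hat8 g β (unif (g ^ 2) β y) / y := by
  have h1 := h.g_mul_sq hy
  have hR := h.rootDelta_eq hy
  have hz := h.unif_pos hy
  have hy0 := h.y_pos hy
  have hq := h.q_pos
  rw [kappa8, hat8, h.sqrt_sq, hR, h1]
  generalize unif (g ^ 2) β y = z at *
  field_simp
  ring

theorem kappa9_eq : kappa9 (g ^ 2) β y = hat9 g β (unif (g ^ 2) β y) / y := by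
  have h1 := h.g_mul_sq hy
  have hR := h.rootDelta_eq hy
  have hz := h.unif_pos hy
  have hy0 := h.y_pos hy
  have he := h.e_pos
  rw [kappa9, hat9, h.sqrt_sq, hR, h1]
  generalize unif (g ^ 2) β y = z at *
  generalize hE : 1 + g ^ 2 - β * g ^ 2 = E at *
  field_simp
  rw [← hE]
  ring

end Params

/-! ### The determinant of the pencil. -/

/-- The determinant of a matrix of the shape of `matK γ β y - s • matH`. -/
theorem det_pencil_shape (k₁ k₂ k₃ k₄ k₅ k₆ k₇ k₈ k₉ q s : ℝ) :
    Matrix.det !![k₁, k₂, 0, -s, 0, 0;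
      k₂, k₂, 0, 0, s, -q;
      0, 0, k₃, k₄, k₅, -s;
      -s, 0, k₄, k₆, k₇, 0;
      0, s, k₅, k₇, k₈, 0;
      0, -q, -s, 0, 0, k₉] =
    -s ^ 6 + s ^ 4 * (k₁ * k₆ - 2 * k₂ * k₇ + k₂ * k₈ + 2 * q * k₅ + k₃ * k₉)
      - s ^ 2 * ((k₁ * k₂ - k₂ ^ 2) * (k₆ * k₈ - k₇ ^ 2)
        + 2 * (k₁ * q) * (-(k₆ * k₅ - k₄ * k₇)) * -1
        + 2 * (k₂ * k₉) * (k₇ * k₃ - k₄ * k₅) * -1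
        + 2 * (k₂ * q) * (k₇ * k₅ - k₄ * k₈) * -1
        + k₁ * k₉ * (k₆ * k₃ - k₄ ^ 2)
        + (k₂ * k₉ - q ^ 2) * (k₈ * k₃ - k₅ ^ 2))
      + (k₁ * (k₂ * k₉ - q ^ 2) - k₂ ^ 2 * k₉) *
        (k₆ * (k₈ * k₃ - k₅ ^ 2) - k₇ * (k₇ * k₃ - k₄ * k₅) + k₄ * (k₇ * k₅ - k₄ * k₈)) := by
  simp [Matrix.det_succ_row_zero, Fin.sum_univ_succ, Fin.succAbove]
  ring

namespace Params

variable {g β : ℝ} (h : Params g β)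
include h

/-- The expansion is even in s, and in each of its coefficients `h1`, `h2`, `h3` the powers of y
cancel. The resulting cubic in s² has the factor s² + βg. -/
theorem det_pencil {y : ℝ} (hy : √(edgeUpper (g ^ 2) β) ≤ y) (s : ℝ) :
    (matK (g ^ 2) β y - s • matH).det = -((s ^ 2 + β * g) *
      (unif (g ^ 2) β y * s ^ 4 + β * (unif (g ^ 2) β y - (1 + g ^ 2 - β * g ^ 2)) * g * s ^ 2
        - β * g ^ 2)) / unif (g ^ 2) β y := by
  have hz := h.unif_pos hy
  have hy0 := h.y_pos hy
  have hβ := h.β_pos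
  have he := h.e_pos
  have hg := h.g_pos
  have hq := h.q_pos
  have hM : matK (g ^ 2) β y - s • matH =
      !![kappa1 (g ^ 2) β y, kappa2 (g ^ 2) β y, 0, -s, 0, 0;
        kappa2 (g ^ 2) β y, kappa2 (g ^ 2) β y, 0, 0, s, -(1 - g ^ 2 * β);
        0, 0, kappa3 (g ^ 2) β y, kappa4 (g ^ 2) β y, kappa5 (g ^ 2) β y, -s;
        -s, 0, kappa4 (g ^ 2) β y, kappa6 (g ^ 2) β y, kappa7 β y, 0;
        0, s, kappa5 (g ^ 2) β y, kappa7 β y, kappa8 (g ^ 2) β y, 0;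
        0, -(1 - g ^ 2 * β), -s, 0, 0, kappa9 (g ^ 2) β y] := by
    ext i j
    fin_cases i <;> fin_cases j <;> simp [matK, matH]
  rw [hM, det_pencil_shape, h.kappa1_eq hy, h.kappa2_eq hy, h.kappa3_eq hy, h.kappa4_eq hy,
    h.kappa5_eq hy, h.kappa6_eq hy, h.kappa8_eq hy, h.kappa9_eq hy, kappa7, mul_comm (g ^ 2) β]
  generalize unif (g ^ 2) β y = z at *
  have h1 : y * hat1 g β z * (hat6 g β z / y) - 2 * (y * hat2 g β z) * ((1 - β) / y)
      + y * hat2 g β z * (hat8 g β z / y) + 2 * (1 - β * g ^ 2) * hat5 g β z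
      + y * hat3 g β z * (hat9 g β z / y) =
      β * g * ((1 + g ^ 2 - β * g ^ 2) / z - 2) := by
    simp only [hat1, hat2, hat3, hat5, hat6, hat8, hat9]
    generalize hEE : 1 + g ^ 2 - β * g ^ 2 = E at *
    generalize hQ : 1 - β * g ^ 2 = Q at *
    field_simp
    subst hEE hQ
    ring
  have h2 : ((y * hat1 g β z * (y * hat2 g β z) - (y * hat2 g β z) ^ 2) *
      (hat6 g β z / y * (hat8 g β z / y) - ((1 - β) / y) ^ 2)
        + 2 * (y * hat1 g β z * (1 - β * g ^ 2)) *
          (-(hat6 g β z / y * hat5 g β z - hat4 g β z * ((1 - β) / y))) * -1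
        + 2 * (y * hat2 g β z * (hat9 g β z / y)) *
          ((1 - β) / y * (y * hat3 g β z) - hat4 g β z * hat5 g β z) * -1
        + 2 * (y * hat2 g β z * (1 - β * g ^ 2)) *
          ((1 - β) / y * hat5 g β z - hat4 g β z * (hat8 g β z / y)) * -1
        + y * hat1 g β z * (hat9 g β z / y) *
          (hat6 g β z / y * (y * hat3 g β z) - hat4 g β z ^ 2)
        + (y * hat2 g β z * (hat9 g β z / y) - (1 - β * g ^ 2) ^ 2) *
          (hat8 g β z / y * (y * hat3 g β z) - hat5 g β z ^ 2)) =
      g ^ 2 * β * (β - (1 + β * (1 + g ^ 2 - β * g ^ 2)) / z) := by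
    simp only [hat1, hat2, hat3, hat4, hat5, hat6, hat8, hat9]
    generalize hEE : 1 + g ^ 2 - β * g ^ 2 = E at *
    generalize hQ : 1 - β * g ^ 2 = Q at *
    field_simp
    subst hEE hQ
    ring
  have h3 : (y * hat1 g β z * (y * hat2 g β z * (hat9 g β z / y) - (1 - β * g ^ 2) ^ 2)
        - (y * hat2 g β z) ^ 2 * (hat9 g β z / y)) *
        (hat6 g β z / y * (hat8 g β z / y * (y * hat3 g β z) - hat5 g β z ^ 2)
          - (1 - β) / y * ((1 - β) / y * (y * hat3 g β z) - hat4 g β z * hat5 g β z)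
          + hat4 g β z * ((1 - β) / y * hat5 g β z - hat4 g β z * (hat8 g β z / y))) =
      g ^ 3 * β ^ 2 / z := by
    -- At s = 0 the matrix decouples into the index sets {0, 1, 5} and {2, 3, 4}; `i1` and `i2` are
    -- the two block determinants.
    have i1 : y * hat1 g β z * (y * hat2 g β z * (hat9 g β z / y) - (1 - β * g ^ 2) ^ 2)
        - (y * hat2 g β z) ^ 2 * (hat9 g β z / y) = -(y * (1 - β * g ^ 2) ^ 2 * g) / (z + (1 + g ^ 2 - β * g ^ 2)) := by
      simp only [hat1, hat2, hat9]
      generalize hEE : 1 + g ^ 2 - β * g ^ 2 = E at *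
      generalize hQ : 1 - β * g ^ 2 = Q at *
      field_simp
      subst hEE hQ
      ring
    have i2 : hat6 g β z / y * (hat8 g β z / y * (y * hat3 g β z) - hat5 g β z ^ 2)
          - (1 - β) / y * ((1 - β) / y * (y * hat3 g β z) - hat4 g β z * hat5 g β z)
          + hat4 g β z * ((1 - β) / y * hat5 g β z - hat4 g β z * (hat8 g β z / y)) =
        -(g ^ 2 * β ^ 2 * (z + (1 + g ^ 2 - β * g ^ 2)) / (y * z * (1 - β * g ^ 2) ^ 2)) := by
      simp only [hat3, hat4, hat5, hat6, hat8]
      generalize hEE : 1 + g ^ 2 - β * g ^ 2 = E at *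
      generalize hQ : 1 - β * g ^ 2 = Q at *
      field_simp
      subst hEE hQ
      ring
    rw [i1, i2]
    field_simp
  rw [h1, h2, h3]
  field_simp
  ring

end Params

/-! ### Positive roots, the threshold and the spike-forward map. -/

/-- The uniformizing parameter at which `√u` is the positive root of the pencil. -/
noncomputable def paramOfRoot (g β u : ℝ) : ℝ :=
  β * g * ((1 + g ^ 2 - β * g ^ 2) * u + g) / (u * (u + β * g))

namespace Params

variable {g β : ℝ} (h : Params g β)
include h

/-- The quadratic in u is affine in z, so it can be solved for z instead. -/
theorem eq_paramOfRoot_iff {z u : ℝ} (hu : 0 < u) : z = paramOfRoot g β u ↔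
    z * u ^ 2 + β * (z - (1 + g ^ 2 - β * g ^ 2)) * g * u - β * g ^ 2 = 0 := by
  have hβ := h.β_pos
  have hg := h.g_pos
  rw [paramOfRoot, eq_div_iff (by positivity), ← sub_eq_zero]
  constructor <;> intro H <;> linear_combination H

theorem paramOfRoot_pos {u : ℝ} (hu : 0 < u) : 0 < paramOfRoot g β u := by
  have hβ := h.β_pos
  have hg := h.g_pos
  have he := h.e_pos
  rw [paramOfRoot]
  positivity

theorem paramOfRoot_strictAntiOn : StrictAntiOn (paramOfRoot g β) (Ioi 0) := by
  intro u (hu : 0 < u) v (hv : 0 < v) huv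
  have hβ := h.β_pos
  have hg := h.g_pos
  have he := h.e_pos
  have := sub_pos.2 huv
  have key : paramOfRoot g β u - paramOfRoot g β v =
      β * g * (v - u) * ((1 + g ^ 2 - β * g ^ 2) * u * v + g * (u + v) + β * g ^ 2) /
        (u * (u + β * g) * (v * (v + β * g))) := by
    rw [paramOfRoot, paramOfRoot]
    field_simp
    ring
  rw [← sub_pos, key]
  positivity

theorem exists_paramOfRoot_eq {z : ℝ} (hz : 0 < z) : ∃ u, 0 < u ∧ z = paramOfRoot g β u := by
  have hβ := h.β_pos
  have hg := h.g_pos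
  set p := β * (z - (1 + g ^ 2 - β * g ^ 2)) * g with hp
  have hd : p ^ 2 < p ^ 2 + 4 * z * (β * g ^ 2) := by
    have : 0 < 4 * z * (β * g ^ 2) := by positivity
    linarith
  have hs := Real.sq_sqrt ((sq_nonneg p).trans hd.le)
  have hlt : p < √(p ^ 2 + 4 * z * (β * g ^ 2)) :=
    (le_abs_self p).trans_lt (by rw [← Real.sqrt_sq_eq_abs]; exact Real.sqrt_lt_sqrt (sq_nonneg _) hd)
  generalize √(p ^ 2 + 4 * z * (β * g ^ 2)) = r at *
  -- The larger root of the quadratic z u² + p u − βg². The constant term is negative, so the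
  -- discriminant exceeds p² and this root is positive.
  have hu : 0 < (r - p) / (2 * z) := div_pos (sub_pos.2 hlt) (by positivity)
  refine ⟨_, hu, (h.eq_paramOfRoot_iff hu).2 ?_⟩
  rw [← hp]
  field_simp
  linear_combination hs

theorem isPosRoot_iff {y : ℝ} (hy : √(edgeUpper (g ^ 2) β) ≤ y) (s : ℝ) :
    IsPosRoot (g ^ 2) β y s ↔ 0 < s ∧ unif (g ^ 2) β y = paramOfRoot g β (s ^ 2) := by
  refine and_congr_right fun hs => ?_
  have hz := h.unif_pos hy
  have hβ := h.β_pos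
  have hg := h.g_pos
  have h0 : s ^ 2 + β * g ≠ 0 := by positivity
  rw [h.det_pencil hy, h.eq_paramOfRoot_iff (pow_pos hs 2), div_eq_zero_iff, neg_eq_zero,
    mul_eq_zero, or_iff_left hz.ne', or_iff_right h0, ← pow_mul]

theorem existsUnique_isPosRoot {y : ℝ} (hy : √(edgeUpper (g ^ 2) β) ≤ y) :
    ∃! s, IsPosRoot (g ^ 2) β y s := by
  obtain ⟨u, hu, hz⟩ := h.exists_paramOfRoot_eq (h.unif_pos hy)
  refine ⟨√u, (h.isPosRoot_iff hy _).2 ⟨Real.sqrt_pos.2 hu, by rwa [Real.sq_sqrt hu.le]⟩, ?_⟩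
  intro s hs
  obtain ⟨hs0, hs⟩ := (h.isPosRoot_iff hy s).1 hs
  have := h.paramOfRoot_strictAntiOn.injOn (mem_Ioi.2 (pow_pos hs0 2)) (mem_Ioi.2 hu)
    (hs.symm.trans hz)
  rw [← this, Real.sqrt_sq hs0.le]

theorem isPosRoot_posRoot {y : ℝ} (hy : √(edgeUpper (g ^ 2) β) ≤ y) :
    IsPosRoot (g ^ 2) β y (posRoot (g ^ 2) β y) :=
  Classical.epsilon_spec (h.existsUnique_isPosRoot hy).exists

theorem posRoot_pos {y : ℝ} (hy : √(edgeUpper (g ^ 2) β) ≤ y) : 0 < posRoot (g ^ 2) β y :=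
  (h.isPosRoot_posRoot hy).1

theorem unif_eq_paramOfRoot {y : ℝ} (hy : √(edgeUpper (g ^ 2) β) ≤ y) :
    unif (g ^ 2) β y = paramOfRoot g β (posRoot (g ^ 2) β y ^ 2) :=
  ((h.isPosRoot_iff hy _).1 (h.isPosRoot_posRoot hy)).2

theorem threshold_pos : 0 < threshold (g ^ 2) β := one_div_pos.2 (h.posRoot_pos le_rfl)

/-- In the variable z, the detection threshold is the branch point. -/
theorem paramOfRoot_threshold : paramOfRoot g β ((1 / threshold (g ^ 2) β) ^ 2) =
    √(β * g ^ 2 * (1 + g ^ 2 - β * g ^ 2)) := by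
  rw [threshold, one_div_one_div, ← h.unif_eq_paramOfRoot le_rfl, h.unif_edge]

section
variable {σ : ℝ} (hσ : threshold (g ^ 2) β < σ)
include hσ

theorem existsUnique_posRoot_eq :
    ∃! y, √(edgeUpper (g ^ 2) β) < y ∧ posRoot (g ^ 2) β y = 1 / σ := by
  have ht := h.threshold_pos
  have hσ0 : 0 < σ := ht.trans hσ
  have h1 : 0 < 1 / σ := by positivity
  have h2 : 1 / σ < 1 / threshold (g ^ 2) β := one_div_lt_one_div_of_lt ht hσ
  have h3 : (1 / σ) ^ 2 < (1 / threshold (g ^ 2) β) ^ 2 := pow_lt_pow_left₀ h2 h1.le two_ne_zero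
  -- Since `paramOfRoot` decreases, σ above the threshold puts z beyond the branch point, where
  -- every value is attained.
  have h4 := h.paramOfRoot_strictAntiOn (mem_Ioi.2 (pow_pos h1 2))
    (mem_Ioi.2 ((pow_pos h1 2).trans h3)) h3
  rw [h.paramOfRoot_threshold] at h4
  obtain ⟨y, hy, hz⟩ := h.exists_unif_eq h4
  refine ⟨y, ⟨hy, ?_⟩, ?_⟩
  · exact (h.existsUnique_isPosRoot hy.le).unique (h.isPosRoot_posRoot hy.le)
      ((h.isPosRoot_iff hy.le _).2 ⟨h1, hz⟩)
  · rintro y' ⟨hy', hs⟩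
    refine h.unif_injOn hy'.le hy.le ?_
    rw [h.unif_eq_paramOfRoot hy'.le, hs, hz]

theorem spikeForward_spec : √(edgeUpper (g ^ 2) β) < spikeForward (g ^ 2) β σ ∧
    posRoot (g ^ 2) β (spikeForward (g ^ 2) β σ) = 1 / σ := by
  obtain ⟨y, hy, hs⟩ := (h.existsUnique_posRoot_eq hσ).exists
  have : ∃ y ∈ Ioi √(edgeUpper (g ^ 2) β), posRoot (g ^ 2) β y = 1 / σ := ⟨y, hy, hs⟩
  exact ⟨Function.invFunOn_mem this, Function.invFunOn_eq this⟩

theorem unif_spikeForward :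
    unif (g ^ 2) β (spikeForward (g ^ 2) β σ) = paramOfRoot g β ((1 / σ) ^ 2) := by
  obtain ⟨hy, hs⟩ := h.spikeForward_spec hσ
  rw [h.unif_eq_paramOfRoot hy.le, hs]

end

end Params

/-! ### Derivatives in y: the entries of 𝒯. -/

namespace Params

variable {g β : ℝ} (h : Params g β)
include h

/-- This agrees with implicit differentiation of g y² = z + (1 + g²) + ce/z. The denominator z² − ce
is the singularity at the edge that forces the overlaps to vanish. -/
theorem hasDerivAt_unif {y : ℝ} (hy : √(edgeUpper (g ^ 2) β) < y) :
    HasDerivAt (unif (g ^ 2) β) (2 * g * y * unif (g ^ 2) β y ^ 2 /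
      (unif (g ^ 2) β y ^ 2 - β * g ^ 2 * (1 + g ^ 2 - β * g ^ 2))) y := by
  have hz := h.unif_pos hy.le
  have hR := h.rootDelta_pos hy
  have hR' := h.rootDelta_eq hy.le
  have hz2 := sub_pos.2 (h.ce_lt_unif_sq hy)
  have hsq := h.rootDelta_sq hy.le
  have h0 : HasDerivAt (fun t : ℝ => g * t ^ 2 - (1 + g ^ 2)) (g * (2 * y)) y := by
    simpa using (((hasDerivAt_id y).pow 2).const_mul g).sub_const (1 + g ^ 2)
  have h1 : HasDerivAt (fun t : ℝ => (g * t ^ 2 - (1 + g ^ 2)) ^ 2 -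
      4 * (β * g ^ 2 * (1 + g ^ 2 - β * g ^ 2)))
      (2 * (g * y ^ 2 - (1 + g ^ 2)) * (g * (2 * y))) y := by
    simpa using (h0.pow 2).sub_const (4 * (β * g ^ 2 * (1 + g ^ 2 - β * g ^ 2)))
  have hfun : rootDelta (g ^ 2) β = fun t => √((g * t ^ 2 - (1 + g ^ 2)) ^ 2 -
      4 * (β * g ^ 2 * (1 + g ^ 2 - β * g ^ 2))) := by
    ext t; rw [rootDelta, h.neg_mul_Delta]
  have h2 : HasDerivAt (rootDelta (g ^ 2) β) (2 * (g * y ^ 2 - (1 + g ^ 2)) * (g * (2 * y)) /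
      (2 * rootDelta (g ^ 2) β y)) y := by
    have := h1.sqrt (by rw [← hsq]; positivity)
    rw [hfun]
    exact this
  have h3 : HasDerivAt (unif (g ^ 2) β) ((g * (2 * y) +
      2 * (g * y ^ 2 - (1 + g ^ 2)) * (g * (2 * y)) / (2 * rootDelta (g ^ 2) β y)) / 2) y := by
    have hfun : unif (g ^ 2) β = fun t => (g * t ^ 2 - (1 + g ^ 2) + rootDelta (g ^ 2) β t) / 2 := by
      ext t; rw [unif, h.sqrt_sq]
    rw [hfun]
    exact (h0.add h2).div_const 2
  refine h3.congr_deriv ?_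
  have h4 : g * y ^ 2 - (1 + g ^ 2) = 2 * unif (g ^ 2) β y - rootDelta (g ^ 2) β y := by
    rw [unif, h.sqrt_sq]; ring
  have h5 : unif (g ^ 2) β y ^ 2 - β * g ^ 2 * (1 + g ^ 2 - β * g ^ 2) =
      rootDelta (g ^ 2) β y * unif (g ^ 2) β y := by
    rw [hR']; field_simp
  rw [h4, h5]
  generalize unif (g ^ 2) β y = z at *
  field_simp
  ring

section tau

variable {y f' : ℝ} {κ f : ℝ → ℝ} (hy : √(edgeUpper (g ^ 2) β) < y)
  (hf : HasDerivAt f f' (unif (g ^ 2) β y))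
include hy hf

theorem hasDerivAt_comp_unif {k : ℝ → ℝ}
    (hk : ∀ t, √(edgeUpper (g ^ 2) β) ≤ t → k t = f (unif (g ^ 2) β t)) :
    HasDerivAt k (f' * (2 * g * y * unif (g ^ 2) β y ^ 2 /
      (unif (g ^ 2) β y ^ 2 - β * g ^ 2 * (1 + g ^ 2 - β * g ^ 2)))) y := by
  refine (hf.comp y (h.hasDerivAt_unif hy)).congr_of_eventuallyEq ?_
  -- The formula for k is known only on the half-line from the edge; strictness of `hy` makes it
  -- hold near y.
  filter_upwards [Ioi_mem_nhds hy] with t ht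
  exact hk t (le_of_lt ht)

theorem tauA_eq (hκ : ∀ t, √(edgeUpper (g ^ 2) β) ≤ t → κ t = t * f (unif (g ^ 2) β t)) :
    tauA κ y = -(1 / 2) * y * (f' * (2 * g * y * unif (g ^ 2) β y ^ 2 /
      (unif (g ^ 2) β y ^ 2 - β * g ^ 2 * (1 + g ^ 2 - β * g ^ 2)))) := by
  rw [tauA, (h.hasDerivAt_comp_unif (k := fun t => 1 / t * κ t) hy hf fun t ht => ?_).deriv]
  have := h.y_pos ht
  rw [hκ t ht]
  field_simp

theorem tauB_eq (hκ : ∀ t, √(edgeUpper (g ^ 2) β) ≤ t → κ t = f (unif (g ^ 2) β t)) :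
    tauB κ y = -(1 / 2) * (f' * (2 * g * y * unif (g ^ 2) β y ^ 2 /
      (unif (g ^ 2) β y ^ 2 - β * g ^ 2 * (1 + g ^ 2 - β * g ^ 2)))) := by
  rw [tauB, (h.hasDerivAt_comp_unif hy hf hκ).deriv]

theorem tauC_eq (hκ : ∀ t, √(edgeUpper (g ^ 2) β) ≤ t → κ t = f (unif (g ^ 2) β t) / t) :
    tauC κ y = -(1 / (2 * y)) * (f' * (2 * g * y * unif (g ^ 2) β y ^ 2 /
      (unif (g ^ 2) β y ^ 2 - β * g ^ 2 * (1 + g ^ 2 - β * g ^ 2)))) := by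
  rw [tauC, (h.hasDerivAt_comp_unif (k := fun t => t * κ t) hy hf fun t ht => ?_).deriv]
  have := h.y_pos ht
  rw [hκ t ht]
  field_simp

end tau

end Params

section hatDerivatives

variable {g β z : ℝ}

theorem hasDerivAt_hat1 (hc : z + β * g ^ 2 ≠ 0) (he : z + (1 + g ^ 2 - β * g ^ 2) ≠ 0) :
    HasDerivAt (hat1 g β) (g * (((z + β * g ^ 2) * (z + (1 + g ^ 2 - β * g ^ 2)) -
      (z + β * g ^ 2 * (1 + g ^ 2 - β * g ^ 2)) * (2 * z + 1 + g ^ 2)) /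
        ((z + β * g ^ 2) * (z + (1 + g ^ 2 - β * g ^ 2))) ^ 2)) z := by
  have h1 := ((hasDerivAt_id z).add_const (β * g ^ 2 * (1 + g ^ 2 - β * g ^ 2))).const_mul g
  have h2 := ((hasDerivAt_id z).add_const (β * g ^ 2)).mul
    ((hasDerivAt_id z).add_const (1 + g ^ 2 - β * g ^ 2))
  refine HasDerivAt.congr_deriv (h1.div h2 (mul_ne_zero hc he)) ?_
  simp only [id, ← mul_div_assoc]
  congr 1
  ring

theorem hasDerivAt_hat2 (hc : z + β * g ^ 2 ≠ 0) (he : z + (1 + g ^ 2 - β * g ^ 2) ≠ 0) :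
    HasDerivAt (hat2 g β) (g * (1 - β * g ^ 2) *
      ((β * g ^ 2 * (1 + g ^ 2 - β * g ^ 2) - z ^ 2) /
        ((z + β * g ^ 2) * (z + (1 + g ^ 2 - β * g ^ 2))) ^ 2)) z := by
  have h1 := (hasDerivAt_id z).const_mul (g * (1 - β * g ^ 2))
  have h2 := ((hasDerivAt_id z).add_const (β * g ^ 2)).mul
    ((hasDerivAt_id z).add_const (1 + g ^ 2 - β * g ^ 2))
  refine HasDerivAt.congr_deriv (h1.div h2 (mul_ne_zero hc he)) ?_
  simp only [id, ← mul_div_assoc]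
  congr 1
  ring

theorem hasDerivAt_hat3 (hq : 1 - β * g ^ 2 ≠ 0) (hc : z + β * g ^ 2 ≠ 0) :
    HasDerivAt (hat3 g β) (β * g ^ 2 * (β * g ^ 2 - z) /
      ((1 - β * g ^ 2) * (z + β * g ^ 2) ^ 3)) z := by
  have h1 := (hasDerivAt_id z).const_mul (β * g ^ 2)
  have h2 := (((hasDerivAt_id z).add_const (β * g ^ 2)).pow 2).const_mul (1 - β * g ^ 2)
  refine HasDerivAt.congr_deriv (h1.div h2 (mul_ne_zero hq (pow_ne_zero 2 hc))) ?_
  simp only [id]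
  field_simp
  ring

theorem hasDerivAt_hat4 (hc : z + β * g ^ 2 ≠ 0) :
    HasDerivAt (hat4 g β) (-(β * g) / (z + β * g ^ 2) ^ 2) z := by
  have h2 := (hasDerivAt_id z).add_const (β * g ^ 2)
  refine HasDerivAt.congr_deriv ((hasDerivAt_const z (β * g)).div h2 hc) ?_
  simp

theorem hasDerivAt_hat6 (hz : z ≠ 0) :
    HasDerivAt (hat6 g β) (-(β * (1 + g ^ 2 - β * g ^ 2)) / z ^ 2) z := by
  have h1 := (hasDerivAt_id z).add_const (β * (1 + g ^ 2 - β * g ^ 2))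
  refine HasDerivAt.congr_deriv (h1.div (hasDerivAt_id z) hz) ?_
  simp only [id]
  congr 1
  ring

theorem hasDerivAt_hat9 (hz : z ≠ 0) :
    HasDerivAt (hat9 g β) (-(g * (1 - β) * (1 - β * g ^ 2) * (β * g ^ 2)) / z ^ 2) z := by
  have h1 := ((hasDerivAt_id z).add_const (β * g ^ 2)).const_mul (g * (1 - β) * (1 - β * g ^ 2))
  refine HasDerivAt.congr_deriv (h1.div (hasDerivAt_id z) hz) ?_
  simp only [id]
  congr 1
  ring

end hatDerivatives

/-! ### The kernel of the pencil. -/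

theorem pencil_mulVec_eq_zero_iff (γ β y s : ℝ) (d : Fin 6 → ℝ) :
    (matK γ β y - s • matH).mulVec d = 0 ↔
      kappa1 γ β y * d 0 + kappa2 γ β y * d 1 = s * d 3 ∧
      kappa2 γ β y * d 0 + kappa2 γ β y * d 1 + s * d 4 = (1 - γ * β) * d 5 ∧
      kappa3 γ β y * d 2 + kappa4 γ β y * d 3 + kappa5 γ β y * d 4 = s * d 5 ∧
      kappa4 γ β y * d 2 + kappa6 γ β y * d 3 + kappa7 β y * d 4 = s * d 0 ∧
      s * d 1 + kappa5 γ β y * d 2 + kappa7 β y * d 3 + kappa8 γ β y * d 4 = 0 ∧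
      kappa9 γ β y * d 5 = (1 - γ * β) * d 1 + s * d 2 := by
  simp only [funext_iff, Fin.forall_fin_succ, Matrix.mulVec, dotProduct, Fin.sum_univ_six]
  simp [matK, matH]
  refine and_congr ?_ (and_congr ?_ (and_congr ?_ (and_congr ?_ (and_congr ?_ ?_)))) <;>
    constructor <;> intro H <;> linear_combination H

/-- A vector spanning the kernel of the pencil at the root `s`. -/
noncomputable def spanVec (g β z y s : ℝ) : Fin 6 → ℝ :=
  ![s * z * (s ^ 2 + β * g) * (s ^ 2 + g),
    s * (1 - β) * g * (β * g ^ 3 - z * s ^ 2),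
    (1 - β * g ^ 2) * (1 - β) * g * s ^ 2 * (z + β * g ^ 2),
    y * (g * s ^ 2 * z * (s ^ 2 + β * g)),
    0,
    y * (s * g ^ 2 * β * z * (s ^ 2 + g) / (z + β * g ^ 2))]

namespace Params

variable {g β : ℝ} (h : Params g β)
include h

theorem spanVec_mem_ker {y s : ℝ} (hy : √(edgeUpper (g ^ 2) β) ≤ y) (hs : 0 < s)
    (hz : unif (g ^ 2) β y = paramOfRoot g β (s ^ 2)) :
    (matK (g ^ 2) β y - s • matH).mulVec (spanVec g β (unif (g ^ 2) β y) y s) = 0 := by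
  have hrel := (h.eq_paramOfRoot_iff (pow_pos hs 2)).1 hz
  have hz := h.unif_pos hy
  have hy0 := h.y_pos hy
  have hβ := h.β_pos
  have he := h.e_pos
  have hg := h.g_pos
  have hq := h.q_pos
  rw [pencil_mulVec_eq_zero_iff, h.kappa1_eq hy, h.kappa2_eq hy, h.kappa3_eq hy, h.kappa4_eq hy,
    h.kappa5_eq hy, h.kappa6_eq hy, h.kappa8_eq hy, h.kappa9_eq hy, kappa7, mul_comm (g ^ 2) β]
  generalize unif (g ^ 2) β y = z at *
  simp only [spanVec, hat1, hat2, hat3, hat4, hat5, hat6, hat8, hat9, Matrix.cons_val]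
  generalize hE : 1 + g ^ 2 - β * g ^ 2 = E at *
  generalize hQ : 1 - β * g ^ 2 = Q at *
  refine ⟨?_, ?_, ?_, ?_, ?_, ?_⟩ <;> field_simp <;> subst hE hQ
  -- Only rows 0, 1 and 3 use the root relation; the other three hold identically in z and s.
  · linear_combination -(z + g ^ 2) * hrel
  · linear_combination y * g * (1 - β * g ^ 2) * z * hrel
  · ring
  · linear_combination -s ^ 2 * y * hrel
  · ring
  · ring

/-- A combination of rows 1 to 4 eliminates d₀, d₁ and d₅. The identities `e1` and `e2` then kill
the coefficients of d₂ and d₃, leaving (s² + βg) d₄ = 0. No root relation is needed. -/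
theorem ker_apply_four_eq_zero {y s : ℝ} (hy : √(edgeUpper (g ^ 2) β) ≤ y) {d : Fin 6 → ℝ}
    (hd : (matK (g ^ 2) β y - s • matH).mulVec d = 0) : d 4 = 0 := by
  have hz := h.unif_pos hy
  have hy0 := h.y_pos hy
  have hβ := h.β_pos
  have he := h.e_pos
  have hg := h.g_pos
  have hq := h.q_pos
  rw [pencil_mulVec_eq_zero_iff, h.kappa2_eq hy, h.kappa3_eq hy, h.kappa4_eq hy,
    h.kappa5_eq hy, h.kappa6_eq hy, h.kappa8_eq hy, kappa7, mul_comm (g ^ 2) β] at hd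
  obtain ⟨-, h1, h2, h3, h4, -⟩ := hd
  generalize unif (g ^ 2) β y = z at *
  have e1 : y * hat2 g β z * (hat4 g β z - hat5 g β z)
      - (1 - β * g ^ 2) * (y * hat3 g β z) = 0 := by
    simp only [hat2, hat3, hat4, hat5]
    generalize hE : 1 + g ^ 2 - β * g ^ 2 = E at *
    generalize hQ : 1 - β * g ^ 2 = Q at *
    field_simp
    subst hE hQ
    ring
  have e2 : y * hat2 g β z * (hat6 g β z / y - (1 - β) / y)
      - (1 - β * g ^ 2) * hat4 g β z = 0 := by
    simp only [hat2, hat6, hat4]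
    generalize hE : 1 + g ^ 2 - β * g ^ 2 = E at *
    generalize hQ : 1 - β * g ^ 2 = Q at *
    field_simp
    subst hE hQ
    ring
  have e3 : y * hat2 g β z * ((1 - β) / y - hat8 g β z / y)
      - (1 - β * g ^ 2) * hat5 g β z = β * g := by
    simp only [hat2, hat5, hat8]
    generalize hE : 1 + g ^ 2 - β * g ^ 2 = E at *
    generalize hQ : 1 - β * g ^ 2 = Q at *
    field_simp
    subst hE hQ
    ring
  have key : (s ^ 2 + β * g) * d 4 = 0 := by
    linear_combination s * h1 + y * hat2 g β z * h3 - y * hat2 g β z * h4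
      - (1 - β * g ^ 2) * h2 - d 2 * e1 - d 3 * e2 - d 4 * e3
  exact (mul_eq_zero.1 key).resolve_left (by positivity)

/-- Kernel vectors are determined by coordinate 3, so the kernel is at most a line. With d₃ = d₄ =
0, rows 2, 4 and 5 combine to (s² + βg) d₂ = 0, and the remaining coordinates follow one row at a
time. -/
theorem ker_eq_zero_of_apply_three {y s : ℝ} (hy : √(edgeUpper (g ^ 2) β) ≤ y) (hs : 0 < s)
    {d : Fin 6 → ℝ} (hd : (matK (g ^ 2) β y - s • matH).mulVec d = 0) (hd3 : d 3 = 0) :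
    d = 0 := by
  have hd4 := h.ker_apply_four_eq_zero hy hd
  have hz := h.unif_pos hy
  have hy0 := h.y_pos hy
  have hβ := h.β_pos
  have hg := h.g_pos
  have hq := h.q_pos
  rw [pencil_mulVec_eq_zero_iff, h.kappa3_eq hy, h.kappa5_eq hy, h.kappa9_eq hy,
    mul_comm (g ^ 2) β, hd3, hd4] at hd
  obtain ⟨-, -, h2, h3, h4, h5⟩ := hd
  generalize unif (g ^ 2) β y = z at *
  have e1 : (1 - β * g ^ 2) * hat5 g β z + hat9 g β z / y * (y * hat3 g β z) = -(β * g) := by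
    simp only [hat3, hat5, hat9]
    generalize hQ : 1 - β * g ^ 2 = Q at *
    field_simp
    subst hQ
    ring
  have key : (s ^ 2 + β * g) * d 2 = 0 := by
    linear_combination -s * h5 - hat9 g β z / y * h2 + d 2 * e1 - (1 - β * g ^ 2) * h4
  have hd2 : d 2 = 0 := (mul_eq_zero.1 key).resolve_left (by positivity)
  rw [hd2] at h2 h3 h4
  have hd0 : d 0 = 0 := by simpa [hs.ne'] using h3.symm
  have hd1 : d 1 = 0 := by simpa [hs.ne'] using h4
  have hd5 : d 5 = 0 := by simpa [hs.ne'] using h2.symm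
  ext i
  fin_cases i <;> assumption

theorem exists_smul_spanVec {y s : ℝ} (hy : √(edgeUpper (g ^ 2) β) ≤ y) (hs : 0 < s)
    (hz : unif (g ^ 2) β y = paramOfRoot g β (s ^ 2)) {d : Fin 6 → ℝ}
    (hd : (matK (g ^ 2) β y - s • matH).mulVec d = 0) :
    ∃ t : ℝ, d = t • spanVec g β (unif (g ^ 2) β y) y s := by
  have hk := h.spanVec_mem_ker hy hs hz
  have hz := h.unif_pos hy
  have hy0 := h.y_pos hy
  have hβ := h.β_pos
  have hg := h.g_pos
  generalize hv : spanVec g β (unif (g ^ 2) β y) y s = v at *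
  have hv3 : v 3 ≠ 0 := by
    rw [← hv]
    simp only [spanVec, Matrix.cons_val]
    positivity
  refine ⟨d 3 / v 3, sub_eq_zero.1 (h.ker_eq_zero_of_apply_three hy hs ?_ ?_)⟩
  · rw [Matrix.mulVec_sub, Matrix.mulVec_smul, hd, hk, smul_zero, sub_zero]
  · simp [hv3]

end Params

/-! ### The 𝒯-form on the kernel. -/

namespace Params

variable {g β : ℝ} (h : Params g β)
include h

/-- The hypothesis on h₁ is row 1 of the kernel equations with d₄ = 0, which expresses h₀ + h₁
through h₅. Since 2h₀h₁ + h₁² = (h₀ + h₁)² − h₀², it eliminates h₁ and leaves no h₀h₅ cross term. -/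
theorem hat_deriv_form_reduce {z h₀ h₁ h₂ h₃ h₅ : ℝ} (hz : 0 < z)
    (h₀₁ : h₁ = (z + β * g ^ 2) * (z + (1 + g ^ 2 - β * g ^ 2)) * h₅ / (g * z) - h₀) :
    g * (((z + β * g ^ 2) * (z + (1 + g ^ 2 - β * g ^ 2)) -
      (z + β * g ^ 2 * (1 + g ^ 2 - β * g ^ 2)) * (2 * z + 1 + g ^ 2)) /
        ((z + β * g ^ 2) * (z + (1 + g ^ 2 - β * g ^ 2))) ^ 2) * h₀ ^ 2
    + g * (1 - β * g ^ 2) * ((β * g ^ 2 * (1 + g ^ 2 - β * g ^ 2) - z ^ 2) /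
        ((z + β * g ^ 2) * (z + (1 + g ^ 2 - β * g ^ 2))) ^ 2) * (2 * h₀ * h₁ + h₁ ^ 2)
    + β * g ^ 2 * (β * g ^ 2 - z) / ((1 - β * g ^ 2) * (z + β * g ^ 2) ^ 3) * h₂ ^ 2
    + -(β * g) / (z + β * g ^ 2) ^ 2 * (2 * h₂ * h₃)
    + -(β * (1 + g ^ 2 - β * g ^ 2)) / z ^ 2 * h₃ ^ 2
    + -(g * (1 - β) * (1 - β * g ^ 2) * (β * g ^ 2)) / z ^ 2 * h₅ ^ 2 =
    -(g * (β * g ^ 2) * h₀ ^ 2 / (z + β * g ^ 2) ^ 2)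
    + (1 - β * g ^ 2) * (β * g ^ 2 - z ^ 2) / (g * z ^ 2) * h₅ ^ 2
    + β * g ^ 2 * (β * g ^ 2 - z) / ((1 - β * g ^ 2) * (z + β * g ^ 2) ^ 3) * h₂ ^ 2
    + -(β * g) / (z + β * g ^ 2) ^ 2 * (2 * h₂ * h₃)
    + -(β * (1 + g ^ 2 - β * g ^ 2)) / z ^ 2 * h₃ ^ 2 := by
  have hβ := h.β_pos
  have he := h.e_pos
  have hg := h.g_pos
  have key : g * (((z + β * g ^ 2) * (z + (1 + g ^ 2 - β * g ^ 2)) -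
      (z + β * g ^ 2 * (1 + g ^ 2 - β * g ^ 2)) * (2 * z + 1 + g ^ 2)) /
        ((z + β * g ^ 2) * (z + (1 + g ^ 2 - β * g ^ 2))) ^ 2) * h₀ ^ 2
    + g * (1 - β * g ^ 2) * ((β * g ^ 2 * (1 + g ^ 2 - β * g ^ 2) - z ^ 2) /
        ((z + β * g ^ 2) * (z + (1 + g ^ 2 - β * g ^ 2))) ^ 2) * (2 * h₀ * h₁ + h₁ ^ 2)
    + -(g * (1 - β) * (1 - β * g ^ 2) * (β * g ^ 2)) / z ^ 2 * h₅ ^ 2 =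
    -(g * (β * g ^ 2) * h₀ ^ 2 / (z + β * g ^ 2) ^ 2)
    + (1 - β * g ^ 2) * (β * g ^ 2 - z ^ 2) / (g * z ^ 2) * h₅ ^ 2 := by
    rw [h₀₁]
    generalize hE : 1 + g ^ 2 - β * g ^ 2 = E at *
    field_simp
    subst hE
    ring
  linear_combination key

/-- On the root curve everything is rational in u. The factorizations of z + c and z u² + c (`hzc`,
`hN`) make the sum collapse to a single product. -/
theorem reduced_form_eq {z u : ℝ} (hu : 0 < u) (hz : z = paramOfRoot g β u) :
    -(g * (β * g ^ 2) * (u * (z * (u + β * g) * (u + g)) ^ 2) / (z + β * g ^ 2) ^ 2)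
    + (1 - β * g ^ 2) * (β * g ^ 2 - z ^ 2) / (g * z ^ 2) *
      (u * (g ^ 2 * β * z * (u + g) / (z + β * g ^ 2)) ^ 2)
    + β * g ^ 2 * (β * g ^ 2 - z) / ((1 - β * g ^ 2) * (z + β * g ^ 2) ^ 3) *
      ((1 - β * g ^ 2) * (1 - β) * g * u * (z + β * g ^ 2)) ^ 2
    + -(β * g) / (z + β * g ^ 2) ^ 2 *
      (2 * ((1 - β * g ^ 2) * (1 - β) * g * u * (z + β * g ^ 2)) * (g * u * z * (u + β * g)))
    + -(β * (1 + g ^ 2 - β * g ^ 2)) / z ^ 2 * (g * u * z * (u + β * g)) ^ 2 =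
    -(g * u ^ 3 * (u + β * g) * (u + g) * z *
      (z * (u + β * g) ^ 2 + (1 - β * g ^ 2) * (1 - β) * β * g ^ 2) /
        (z * u ^ 2 + β * g ^ 2)) := by
  have hβ := h.β_pos
  have he := h.e_pos
  have hg := h.g_pos
  have hq := h.q_pos
  have hzc : z + β * g ^ 2 = β * g * (u + g) * (g * u + 1) / (u * (u + β * g)) := by
    rw [hz, paramOfRoot]; field_simp; ring
  have hN : z * u ^ 2 + β * g ^ 2 =
      β * g * ((1 + g ^ 2 - β * g ^ 2) * u ^ 2 + 2 * g * u + β * g ^ 2) / (u + β * g) := by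
    rw [hz, paramOfRoot]; field_simp; ring
  rw [hzc, hN, hz, paramOfRoot]
  generalize hE : 1 + g ^ 2 - β * g ^ 2 = E at *
  generalize hQ : 1 - β * g ^ 2 = Q at *
  field_simp
  subst hE hQ
  ring

end Params

theorem dotProduct_matT_mulVec (γ β y : ℝ) {d : Fin 6 → ℝ} (hd : d 4 = 0) :
    d ⬝ᵥ (matT γ β y).mulVec d =
      tauA (kappa1 γ β) y * d 0 ^ 2 + tauA (kappa2 γ β) y * (2 * d 0 * d 1 + d 1 ^ 2)
      + tauA (kappa3 γ β) y * d 2 ^ 2 + tauB (kappa4 γ β) y * (2 * d 2 * d 3)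
      + tauC (kappa6 γ β) y * d 3 ^ 2 + tauC (kappa9 γ β) y * d 5 ^ 2 := by
  simp only [Matrix.mulVec, dotProduct, Fin.sum_univ_six]
  simp [matT, hd]
  ring

/-- The squared overlap of the left singular vectors, in terms of `u = 1 / σ²`. -/
noncomputable def sqOverlapU (g β u : ℝ) : ℝ :=
  (u + β * g) * (paramOfRoot g β u ^ 2 - β * g ^ 2 * (1 + g ^ 2 - β * g ^ 2)) *
    (paramOfRoot g β u * u ^ 2 + β * g ^ 2) /
  (paramOfRoot g β u * (u + g) * (paramOfRoot g β u * (u + β * g) ^ 2 +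
    (1 - β * g ^ 2) * (1 - β) * β * g ^ 2))

/-- The squared overlap of the right singular vectors, in terms of `u = 1 / σ²`. -/
noncomputable def sqOverlapV (g β u : ℝ) : ℝ :=
  (u + β * g) * (u + g) * (paramOfRoot g β u ^ 2 - β * g ^ 2 * (1 + g ^ 2 - β * g ^ 2)) *
    (paramOfRoot g β u * u ^ 2 + β * g ^ 2) /
  (g * ((paramOfRoot g β u + β * g ^ 2) * (paramOfRoot g β u + (1 + g ^ 2 - β * g ^ 2))) * u *
    (paramOfRoot g β u * (u + β * g) ^ 2 + (1 - β * g ^ 2) * (1 - β) * β * g ^ 2))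

namespace Params

variable {g β : ℝ} (h : Params g β)
include h

theorem spanVec_matT {y s : ℝ} (hy : √(edgeUpper (g ^ 2) β) < y) (hs : 0 < s)
    (hz : unif (g ^ 2) β y = paramOfRoot g β (s ^ 2)) :
    spanVec g β (unif (g ^ 2) β y) y s ⬝ᵥ
        (matT (g ^ 2) β y).mulVec (spanVec g β (unif (g ^ 2) β y) y s) =
      g ^ 2 * y ^ 2 * unif (g ^ 2) β y ^ 3 * (s ^ 2) ^ 3 * (s ^ 2 + β * g) * (s ^ 2 + g) *
        (unif (g ^ 2) β y * (s ^ 2 + β * g) ^ 2 + (1 - β * g ^ 2) * (1 - β) * β * g ^ 2) /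
      ((unif (g ^ 2) β y ^ 2 - β * g ^ 2 * (1 + g ^ 2 - β * g ^ 2)) *
        (unif (g ^ 2) β y * (s ^ 2) ^ 2 + β * g ^ 2)) := by
  have hrel := (h.eq_paramOfRoot_iff (pow_pos hs 2)).1 hz
  have hred := h.reduced_form_eq (pow_pos hs 2) hz
  have hz := h.unif_pos hy.le
  have hy0 := h.y_pos hy.le
  have hβ := h.β_pos
  have hg := h.g_pos
  have he := h.e_pos
  have hq := h.q_pos
  have hc : 0 < unif (g ^ 2) β y + β * g ^ 2 := by positivity
  have hze : 0 < unif (g ^ 2) β y + (1 + g ^ 2 - β * g ^ 2) := by positivity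
  have hd := sub_pos.2 (h.ce_lt_unif_sq hy)
  rw [dotProduct_matT_mulVec _ _ _ (by simp [spanVec]),
    h.tauA_eq hy (hasDerivAt_hat1 hc.ne' hze.ne') fun _ => h.kappa1_eq,
    h.tauA_eq hy (hasDerivAt_hat2 hc.ne' hze.ne') fun _ => h.kappa2_eq,
    h.tauA_eq hy (hasDerivAt_hat3 hq.ne' hc.ne') fun _ => h.kappa3_eq,
    h.tauB_eq hy (hasDerivAt_hat4 hc.ne') fun _ => h.kappa4_eq,
    h.tauC_eq hy (hasDerivAt_hat6 hz.ne') fun _ => h.kappa6_eq,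
    h.tauC_eq hy (hasDerivAt_hat9 hz.ne') fun _ => h.kappa9_eq]
  generalize unif (g ^ 2) β y = z at *
  -- Row 1 of the kernel equations again, with the factor y of coordinate 5 removed.
  have h₀₁ : s * (1 - β) * g * (β * g ^ 3 - z * s ^ 2) =
      (z + β * g ^ 2) * (z + (1 + g ^ 2 - β * g ^ 2)) *
        (s * g ^ 2 * β * z * (s ^ 2 + g) / (z + β * g ^ 2)) / (g * z)
        - s * z * (s ^ 2 + β * g) * (s ^ 2 + g) := by
    generalize hE : 1 + g ^ 2 - β * g ^ 2 = E at *
    field_simp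
    subst hE
    linear_combination hrel
  have hform := h.hat_deriv_form_reduce (h₂ := (1 - β * g ^ 2) * (1 - β) * g * s ^ 2 *
    (z + β * g ^ 2)) (h₃ := g * s ^ 2 * z * (s ^ 2 + β * g)) hz h₀₁
  rw [show (s * z * (s ^ 2 + β * g) * (s ^ 2 + g)) ^ 2 =
      s ^ 2 * (z * (s ^ 2 + β * g) * (s ^ 2 + g)) ^ 2 by ring] at hform
  rw [show (s * g ^ 2 * β * z * (s ^ 2 + g) / (z + β * g ^ 2)) ^ 2 =
      s ^ 2 * (g ^ 2 * β * z * (s ^ 2 + g) / (z + β * g ^ 2)) ^ 2 by ring] at hform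
  have hform := hform.trans hred
  simp only [spanVec, Matrix.cons_val]
  trans -(1 / 2) * y * (2 * g * y * z ^ 2 / (z ^ 2 - β * g ^ 2 * (1 + g ^ 2 - β * g ^ 2))) *
    -(g * (s ^ 2) ^ 3 * (s ^ 2 + β * g) * (s ^ 2 + g) * z *
      (z * (s ^ 2 + β * g) ^ 2 + (1 - β * g ^ 2) * (1 - β) * β * g ^ 2) /
        (z * (s ^ 2) ^ 2 + β * g ^ 2))
  · rw [← hform]
    generalize 2 * g * y * z ^ 2 / (z ^ 2 - β * g ^ 2 * (1 + g ^ 2 - β * g ^ 2)) = m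
    generalize g * s ^ 2 * z * (s ^ 2 + β * g) = h₃
    generalize hh₅ : g ^ 2 * β * z * (s ^ 2 + g) / (z + β * g ^ 2) = h₅
    rw [show s * g ^ 2 * β * z * (s ^ 2 + g) / (z + β * g ^ 2) = s * h₅ by rw [← hh₅]; ring]
    -- Coordinates 3 and 5 of `spanVec` carry a factor y, which balances the 1/(2y) in `tauC`. Thus
    -- −y/2 · dz/dy comes out of the whole form.
    have e1 : ∀ a b : ℝ, -(1 / (2 * y)) * (a * m) * (y * b) ^ 2 =
        -(1 / 2) * y * m * (a * b ^ 2) := by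
      intro a b; field_simp
    rw [e1, e1]
    ring
  · generalize z ^ 2 - β * g ^ 2 * (1 + g ^ 2 - β * g ^ 2) = D at *
    field_simp

/-! ### Normalization, overlaps and their limits. -/

section
variable {σ : ℝ} (hσ : threshold (g ^ 2) β < σ)
include hσ

theorem exists_normalizedKernel_eq : ∃ w : Fin 6 → ℝ,
    normalizedKernel (g ^ 2) β σ = {w, -w} ∧
      w 3 ^ 2 / σ ^ 2 = sqOverlapU g β ((1 / σ) ^ 2) ∧
      w 0 ^ 2 / σ ^ 2 = sqOverlapV g β ((1 / σ) ^ 2) := by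
  obtain ⟨hy, -⟩ := h.spikeForward_spec hσ
  have hz := h.unif_spikeForward hσ
  have hσ0 : 0 < σ := h.threshold_pos.trans hσ
  unfold normalizedKernel
  generalize spikeForward (g ^ 2) β σ = y at *
  have hs : 0 < 1 / σ := by positivity
  have hQ := h.spanVec_matT hy hs hz
  have hker := h.spanVec_mem_ker hy.le hs hz
  have hspan := fun d hd => h.exists_smul_spanVec (d := d) hy.le hs hz hd
  have hz0 := h.unif_pos hy.le
  have hy0 := h.y_pos hy.le
  have hβ := h.β_pos
  have hg := h.g_pos
  have he := h.e_pos
  have hq := h.q_pos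
  have hb := h.b_nonneg
  have hd := sub_pos.2 (h.ce_lt_unif_sq hy)
  have hgy := h.g_mul_sq hy.le
  rw [sqOverlapU, sqOverlapV, ← hz]
  have hv0 : spanVec g β (unif (g ^ 2) β y) y (1 / σ) 0 =
      1 / σ * unif (g ^ 2) β y * ((1 / σ) ^ 2 + β * g) * ((1 / σ) ^ 2 + g) := rfl
  have hv3 : spanVec g β (unif (g ^ 2) β y) y (1 / σ) 3 =
      y * (g * (1 / σ) ^ 2 * unif (g ^ 2) β y * ((1 / σ) ^ 2 + β * g)) := rfl
  generalize spanVec g β (unif (g ^ 2) β y) y (1 / σ) = v at *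
  generalize unif (g ^ 2) β y = z at *
  have hyy : y ^ 2 = (z + β * g ^ 2) * (z + (1 + g ^ 2 - β * g ^ 2)) / (z * g) := by
    rw [eq_div_iff (by positivity)]
    rw [eq_div_iff hz0.ne'] at hgy
    linear_combination hgy
  -- This is where β ≤ 1 enters: it makes the 𝒯-form positive on the kernel line, so normalization
  -- is possible.
  have hS : 0 < z * ((1 / σ) ^ 2 + β * g) ^ 2 + (1 - β * g ^ 2) * (1 - β) * β * g ^ 2 := by
    positivity
  have hQ0 : 0 < v ⬝ᵥ (matT (g ^ 2) β y).mulVec v := by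
    rw [hQ]; positivity
  have hsq := Real.sq_sqrt hQ0.le
  have hr := Real.sqrt_pos.2 hQ0
  generalize √(v ⬝ᵥ (matT (g ^ 2) β y).mulVec v) = r at *
  have hquad : ∀ t : ℝ, (t • v) ⬝ᵥ (matT (g ^ 2) β y).mulVec (t • v) = (t * r) ^ 2 := by
    intro t
    rw [Matrix.mulVec_smul, smul_dotProduct, dotProduct_smul, ← hsq, smul_eq_mul, smul_eq_mul]
    ring
  refine ⟨r⁻¹ • v, ?_, ?_, ?_⟩
  · ext d
    simp only [mem_ofPred_eq, mem_insert_iff, mem_singleton_iff, ← neg_smul]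
    constructor
    · rintro ⟨h1, h2⟩
      obtain ⟨t, rfl⟩ := hspan d h1
      rw [hquad, sq_eq_one_iff] at h2
      rcases h2 with h2 | h2
      · left
        rw [eq_inv_of_mul_eq_one_left h2]
      · right
        rw [← eq_inv_of_mul_eq_one_left (a := -t) (by rw [neg_mul, h2, neg_neg]), neg_neg]
    · rintro (rfl | rfl)
      · exact ⟨by rw [Matrix.mulVec_smul, hker, smul_zero],
          by rw [hquad, inv_mul_cancel₀ hr.ne', one_pow]⟩
      · exact ⟨by rw [Matrix.mulVec_smul, hker, smul_zero],
          by rw [hquad, neg_mul, inv_mul_cancel₀ hr.ne', neg_one_sq]⟩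
  · rw [Pi.smul_apply, smul_eq_mul, mul_pow, inv_pow, hsq, hQ, hv3]
    generalize z ^ 2 - β * g ^ 2 * (1 + g ^ 2 - β * g ^ 2) = D at *
    generalize z * ((1 / σ) ^ 2 + β * g) ^ 2 + (1 - β * g ^ 2) * (1 - β) * β * g ^ 2 = S at *
    field_simp
  · rw [Pi.smul_apply, smul_eq_mul, mul_pow, inv_pow, hsq, hQ, hv0, hyy]
    generalize z ^ 2 - β * g ^ 2 * (1 + g ^ 2 - β * g ^ 2) = D at *
    generalize z * ((1 / σ) ^ 2 + β * g) ^ 2 + (1 - β * g ^ 2) * (1 - β) * β * g ^ 2 = S at *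
    generalize 1 + g ^ 2 - β * g ^ 2 = E at *
    field_simp

/-- The overlaps see only absolute values of coordinates, so the choice between the two antipodal
vectors is immaterial. -/
theorem overlap_eq : overlapU (g ^ 2) β σ = √(sqOverlapU g β ((1 / σ) ^ 2)) ∧
    overlapV (g ^ 2) β σ = √(sqOverlapV g β ((1 / σ) ^ 2)) := by
  obtain ⟨w, hw, hU, hV⟩ := h.exists_normalizedKernel_eq hσ
  have hσ0 : 0 < σ := h.threshold_pos.trans hσ
  have hmem : kernelVector (g ^ 2) β σ ∈ normalizedKernel (g ^ 2) β σ :=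
    Classical.epsilon_spec (p := fun d => d ∈ normalizedKernel (g ^ 2) β σ)
      ⟨w, by rw [hw]; exact mem_insert _ _⟩
  rw [hw] at hmem
  have habs : ∀ i, |kernelVector (g ^ 2) β σ i| = |w i| := by
    intro i
    rcases hmem with e | e
    · rw [e]
    · rw [mem_singleton_iff.1 e, Pi.neg_apply, abs_neg]
  rw [overlapU, overlapV, habs, habs, ← hU, ← hV, ← div_pow, ← div_pow, Real.sqrt_sq_eq_abs,
    Real.sqrt_sq_eq_abs, abs_div, abs_div, abs_of_pos hσ0]
  exact ⟨rfl, rfl⟩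

end

theorem continuousAt_paramOfRoot {u : ℝ} (hu : 0 < u) : ContinuousAt (paramOfRoot g β) u := by
  have hβ := h.β_pos
  have hg := h.g_pos
  unfold paramOfRoot
  exact ContinuousAt.div (by fun_prop) (by fun_prop) (by positivity)

theorem tendsto_overlaps :
    Tendsto (overlapU (g ^ 2) β) (𝓝[>] threshold (g ^ 2) β) (𝓝 0) ∧
    Tendsto (overlapV (g ^ 2) β) (𝓝[>] threshold (g ^ 2) β) (𝓝 0) := by
  have ht := h.threshold_pos
  have hu : 0 < (1 / threshold (g ^ 2) β) ^ 2 := by positivity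
  have hβ := h.β_pos
  have hg := h.g_pos
  have he := h.e_pos
  have hq := h.q_pos
  have hb := h.b_nonneg
  have hz := h.paramOfRoot_pos hu
  have hp := h.continuousAt_paramOfRoot hu
  -- The common numerator factor z² − ce vanishes at the threshold, while both denominators stay
  -- positive there.
  have hz2 : paramOfRoot g β ((1 / threshold (g ^ 2) β) ^ 2) ^ 2 -
      β * g ^ 2 * (1 + g ^ 2 - β * g ^ 2) = 0 := by
    rw [h.paramOfRoot_threshold, Real.sq_sqrt h.ce_pos.le, sub_self]
  have hU0 : sqOverlapU g β ((1 / threshold (g ^ 2) β) ^ 2) = 0 := by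
    rw [sqOverlapU, hz2, mul_zero, zero_mul, zero_div]
  have hV0 : sqOverlapV g β ((1 / threshold (g ^ 2) β) ^ 2) = 0 := by
    rw [sqOverlapV, hz2, mul_zero, zero_mul, zero_div]
  have hUc : ContinuousAt (sqOverlapU g β) ((1 / threshold (g ^ 2) β) ^ 2) := by
    unfold sqOverlapU
    exact ContinuousAt.div (by fun_prop) (by fun_prop) (by positivity)
  have hVc : ContinuousAt (sqOverlapV g β) ((1 / threshold (g ^ 2) β) ^ 2) := by
    unfold sqOverlapV
    exact ContinuousAt.div (by fun_prop) (by fun_prop) (by positivity)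
  have hs : Tendsto (fun σ : ℝ => (1 / σ) ^ 2) (𝓝[>] threshold (g ^ 2) β)
      (𝓝 ((1 / threshold (g ^ 2) β) ^ 2)) := by
    have : ContinuousAt (fun σ : ℝ => (1 / σ) ^ 2) (threshold (g ^ 2) β) :=
      (continuousAt_const.div continuousAt_id ht.ne').pow 2
    exact this.tendsto.mono_left nhdsWithin_le_nhds
  have hU := (hUc.tendsto.comp hs).sqrt
  have hV := (hVc.tendsto.comp hs).sqrt
  rw [hU0, Real.sqrt_zero] at hU
  rw [hV0, Real.sqrt_zero] at hV
  constructor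
  · refine hU.congr' ?_
    filter_upwards [self_mem_nhdsWithin] with σ hσ using (h.overlap_eq hσ).1.symm
  · refine hV.congr' ?_
    filter_upwards [self_mem_nhdsWithin] with σ hσ using (h.overlap_eq hσ).2.symm

end Params

end RandSVD

theorem mainTheorem6 (γ β : ℝ) (hγ : 0 < γ) (hβ : 0 < β) (hβ1 : β ≤ 1) (hβγ : β * γ < 1) :
    (∀ y : ℝ, √(RandSVD.edgeUpper γ β) ≤ y → ∃! s : ℝ, RandSVD.IsPosRoot γ β y s) ∧
    (∀ σ : ℝ, RandSVD.threshold γ β < σ →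
      ∃! y : ℝ, √(RandSVD.edgeUpper γ β) < y ∧ RandSVD.posRoot γ β y = 1 / σ) ∧
    (∀ σ : ℝ, RandSVD.threshold γ β < σ →
      ∃ d : Fin 6 → ℝ, RandSVD.normalizedKernel γ β σ = {d, -d}) ∧
    Tendsto (RandSVD.overlapU γ β) (𝓝[>] RandSVD.threshold γ β) (𝓝 0) ∧
    Tendsto (RandSVD.overlapV γ β) (𝓝[>] RandSVD.threshold γ β) (𝓝 0) := by
  -- Passing to g = √γ makes all coefficients other than the edges polynomial.
  obtain ⟨g, hg, rfl⟩ : ∃ g : ℝ, 0 < g ∧ g ^ 2 = γ := ⟨√γ, Real.sqrt_pos.2 hγ, Real.sq_sqrt hγ.le⟩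
  have h : RandSVD.Params g β := ⟨hg, hβ, hβ1, hβγ⟩
  exact ⟨fun _ => h.existsUnique_isPosRoot, fun _ => h.existsUnique_posRoot_eq,
    fun _ hσ => (h.exists_normalizedKernel_eq hσ).imp fun _ hw => hw.1, h.tendsto_overlaps⟩
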